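/- Let $L=(L_t)_{t\ge 0}$ be a real-valued Lévy process on a probability space $(\Omega,\mathcal F,\mathbb P)$ (almost surely RCLL paths, $L_0=0$ almost surely, stochastically continuous, with stationary and independent increments) which is not constant, i.e. it is not the case that $L_t=0$ almost surely for every $t\ge 0$. Let $\eta$ be its characteristic exponent, determined by $\mathbb E[e^{iuL_t}]=e^{t\eta(u)}$ for all $u\in\mathbb R$, $t\ge 0$. Let $C_0(\mathbb R)$ be the space of continuous functions $f\colon\mathbb R\to\mathbb R$ vanishing at infinity, with the sup-norm. For the dual Lévy process $L^*_t:=-L_t$ and $f\in C_0(\mathbb R)$ put $P^*_tf(x):=\mathbb E[f(x-L_t)]$ and, for $q>0$, $(U^q)^*f(x):=\int_0^\infty e^{-qt}P^*_tf(x)\,dt$. Let $\mathcal A^*$ be the infinitesimal generator of $L^*$: its domain $D(\mathcal A^*)$ is the set of $f\in C_0(\mathbb R)$ for which $\lim_{t\downarrow 0}t^{-1}(P^*_tf-f)$ exists in $C_0(\mathbb R)$, and $\mathcal A^*f$ is this limit. Write $\hat g(\xi):=\int_{\mathbb R}g(x)e^{i\xi x}\,dx$. If $g\in C_0(\mathbb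 R)\cap L^1(\mathbb R)$ and $\xi\mapsto \hat g(\xi)/\eta(\xi)$ belongs to $L^1(\mathbb R)$ (the zeros of $\eta$ form a Lebesgue null set), then there is a unique $H\in D(\mathcal A^*)\subset C_0(\mathbb R)$ with $\mathcal A^*H=g$, and $$H(x)=\frac1{2\pi}\int_{\mathbb R}\frac{\hat g(\xi)}{\eta(\xi)}\,e^{-ix\xi}\,d\xi,\qquad x\in\mathbb R.$$ Moreover $(U^q)^*g\in C_0(\mathbb R)$ for every $q>0$, and $-(U^q)^*g\to H$ in $C_0(\mathbb R)$ as $q\downarrow 0$. -/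

import Mathlib

open MeasureTheory ProbabilityTheory Filter Topology Set Complex
open scoped NNReal ZeroAtInfty

namespace LevyPoisson

/-- A real-valued process `L = (L_t)_{t ≥ 0}` on `(Ω, P)` is a Lévy process: it has almost surely
right-continuous paths with left limits, starts almost surely from `0`, is stochastically
continuous, and has stationary and independent increments. -/
structure IsLevyProcess {Ω : Type*} [MeasurableSpace Ω] (P : Measure Ω) (L : ℝ≥0 → Ω → ℝ) :
    Prop where
  measurable : ∀ t, Measurable (L t)
  rcll : ∀ᵐ ω ∂P, ∀ t : ℝ≥0, ContinuousWithinAt (fun s => L s ω) (Ioi t) t ∧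
    ∃ l : ℝ, Tendsto (fun s => L s ω) (𝓝[<] t) (𝓝 l)
  zero : ∀ᵐ ω ∂P, L 0 ω = 0
  stochCont : ∀ t : ℝ≥0, TendstoInMeasure P L (𝓝 t) (L t)
  stationary : ∀ s t : ℝ≥0, P.map (fun ω => L (s + t) ω - L s ω) = P.map (fun ω => L t ω - L 0 ω)
  indep : HasIndepIncrements L P

/-- The dual process `L*_t = -L_t`. -/
def dual {Ω : Type*} (L : ℝ≥0 → Ω → ℝ) : ℝ≥0 → Ω → ℝ := fun t ω => -L t ω

open Classical in
/-- The characteristic exponent `η` of the process `L`: the number `η(u)` is determined by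
`E[exp(i u L_t)] = exp(t η(u))` for all `t ≥ 0`. For a Lévy process such a number exists and is
unique, see `exists_exponent`, `exponent_unique` and `charFun_eq_exp` below. -/
noncomputable def exponent {Ω : Type*} [MeasurableSpace Ω] (P : Measure Ω) (L : ℝ≥0 → Ω → ℝ)
    (u : ℝ) : ℂ :=
  if h : ∃ z : ℂ, ∀ t : ℝ≥0, ∫ ω, cexp (I * u * L t ω) ∂P = cexp (t * z) then h.choose else 0

/-- The Fourier transform `ĝ(ξ) = ∫ g(x) e^{i ξ x} dx`. -/
noncomputable def fourierHat (g : ℝ → ℝ) (ξ : ℝ) : ℂ := ∫ x : ℝ, (g x : ℂ) * cexp (I * ξ * x)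

/-- For a finite measure `μ` on the line and `f ∈ C₀(ℝ)`, the function `x ↦ ∫ f(y + x) μ(dy)`,
as an element of `C₀(ℝ)`. -/
noncomputable def translateAverage (μ : Measure ℝ) [IsFiniteMeasure μ] :
    C₀(ℝ, ℝ) →ₗ[ℝ] C₀(ℝ, ℝ) where
  toFun f :=
    { toFun := fun x => ∫ y, f (y + x) ∂μ
      continuous_toFun := by
        refine continuous_of_dominated (bound := fun _ => ‖f.toBCF‖) ?_ ?_ ?_ ?_
        · intro x
          exact (f.continuous.comp (continuous_add_const x)).aestronglyMeasurable
        · intro x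
          exact Eventually.of_forall fun y => f.toBCF.norm_coe_le_norm (y + x)
        · exact integrable_const _
        · exact Eventually.of_forall fun y => f.continuous.comp (continuous_const_add y)
      zero_at_infty' := by
        have key : Tendsto (fun x => ∫ y, f (y + x) ∂μ) (cocompact ℝ) (𝓝 (∫ _, (0 : ℝ) ∂μ)) := by
          have : (cocompact ℝ).IsCountablyGenerated := by
            rw [cocompact_eq_atBot_atTop]; infer_instance
          refine tendsto_integral_filter_of_dominated_convergence (fun _ => ‖f.toBCF‖) ?_ ?_ ?_ ?_
          · exact Eventually.of_forall fun x =>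
              (f.continuous.comp (continuous_add_const x)).aestronglyMeasurable
          · exact Eventually.of_forall fun x =>
              Eventually.of_forall fun y => f.toBCF.norm_coe_le_norm (y + x)
          · exact integrable_const _
          · exact Eventually.of_forall fun y => (zero_at_infty f).comp
              (Homeomorph.addLeft y).isClosedEmbedding.tendsto_cocompact
        simpa using key }
  map_add' f g := by
    ext x
    have h : ∀ k : C₀(ℝ, ℝ), Integrable (fun y => k (y + x)) μ := fun k =>
      Integrable.of_bound (k.continuous.comp (continuous_add_const x)).aestronglyMeasurable
        ‖k.toBCF‖ (Eventually.of_forall fun y => k.toBCF.norm_coe_le_norm (y + x))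
    exact integral_add (h f) (h g)
  map_smul' c f := by
    ext x
    exact integral_const_mul c fun y => f (y + x)

/-- The transition operator `P_t f(x) = E[f(X_t + x)]` on `C₀(ℝ)` (written with the law of `X_t`;
see `transition_apply`). -/
noncomputable def transition {Ω : Type*} [MeasurableSpace Ω] (P : Measure Ω) [IsFiniteMeasure P]
    (X : ℝ≥0 → Ω → ℝ) (t : ℝ≥0) : C₀(ℝ, ℝ) →ₗ[ℝ] C₀(ℝ, ℝ) :=
  translateAverage (P.map (X t))

theorem transition_apply {Ω : Type*} [MeasurableSpace Ω] (P : Measure Ω) [IsFiniteMeasure P]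
    (X : ℝ≥0 → Ω → ℝ) (t : ℝ≥0) (hX : AEMeasurable (X t) P) (f : C₀(ℝ, ℝ)) (x : ℝ) :
    transition P X t f x = ∫ ω, f (X t ω + x) ∂P :=
  integral_map hX (f.continuous.comp (continuous_add_const x)).aestronglyMeasurable

/-- The resolvent `U^q f(x) = ∫_0^∞ e^{-qt} P_t f(x) dt`. -/
noncomputable def resolvent {Ω : Type*} [MeasurableSpace Ω] (P : Measure Ω) [IsFiniteMeasure P]
    (X : ℝ≥0 → Ω → ℝ) (q : ℝ) (f : C₀(ℝ, ℝ)) (x : ℝ) : ℝ :=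
  ∫ t in Ioi (0 : ℝ), Real.exp (-q * t) * transition P X t.toNNReal f x

/-- `h = lim_{t → 0} t⁻¹ (P_t f - f)` in `C₀(ℝ)`. -/
def IsGeneratorLimit {Ω : Type*} [MeasurableSpace Ω] (P : Measure Ω) [IsFiniteMeasure P]
    (X : ℝ≥0 → Ω → ℝ) (f h : C₀(ℝ, ℝ)) : Prop :=
  Tendsto (fun t : ℝ≥0 => (t : ℝ)⁻¹ • (transition P X t f - f)) (𝓝[>] 0) (𝓝 h)

/-- The infinitesimal generator: its domain consists of the `f ∈ C₀(ℝ)` for which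
`lim_{t → 0} t⁻¹ (P_t f - f)` exists in `C₀(ℝ)`, and its value at `f` is this limit. -/
noncomputable def generator {Ω : Type*} [MeasurableSpace Ω] (P : Measure Ω) [IsFiniteMeasure P]
    (X : ℝ≥0 → Ω → ℝ) : C₀(ℝ, ℝ) →ₗ.[ℝ] C₀(ℝ, ℝ) where
  domain :=
    { carrier := {f | ∃ h, IsGeneratorLimit P X f h}
      add_mem' := by
        rintro f g ⟨h, hf⟩ ⟨k, hg⟩
        refine ⟨h + k, (hf.add hg).congr fun t => ?_⟩
        ext x; simp; ring
      zero_mem' := ⟨0, by simp [IsGeneratorLimit]⟩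
      smul_mem' := by
        rintro c f ⟨h, hf⟩
        refine ⟨c • h, (hf.const_smul c).congr fun t => ?_⟩
        ext x; simp; ring }
  toFun :=
    { toFun := fun f => f.2.choose
      map_add' := by
        rintro f g
        refine tendsto_nhds_unique (f + g).2.choose_spec
          ((f.2.choose_spec.add g.2.choose_spec).congr fun t => ?_)
        ext x; simp; ring
      map_smul' := by
        rintro c f
        refine tendsto_nhds_unique (c • f).2.choose_spec
          ((f.2.choose_spec.const_smul c).congr fun t => ?_)
        ext x; simp; ring }

theorem mem_generator_domain {Ω : Type*} [MeasurableSpace Ω] (P : Measure Ω) [IsFiniteMeasure P]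
    (X : ℝ≥0 → Ω → ℝ) (f : C₀(ℝ, ℝ)) :
    f ∈ (generator P X).domain ↔ ∃ h, IsGeneratorLimit P X f h := Iff.rfl

theorem generator_eq_iff {Ω : Type*} [MeasurableSpace Ω] (P : Measure Ω) [IsFiniteMeasure P]
    (X : ℝ≥0 → Ω → ℝ) (f : (generator P X).domain) (h : C₀(ℝ, ℝ)) :
    generator P X f = h ↔ IsGeneratorLimit P X f h := by
  have hs : IsGeneratorLimit P X f (generator P X f) := f.2.choose_spec
  exact ⟨fun e => e ▸ hs, fun hh => tendsto_nhds_unique hs hh⟩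

/-- The number `η(u)` with `E[exp(i u L_t)] = exp(t η(u))` for all `t ≥ 0` is unique. -/
theorem exponent_unique {z w : ℂ} (h : ∀ t : ℝ≥0, cexp (t * z) = cexp (t * w)) : z = w := by
  have d : ∀ v : ℂ, HasDerivWithinAt (fun t : ℝ => cexp (t * v)) v (Ici 0) 0 := fun v => by
    have := ((Complex.ofRealCLM.hasDerivAt (x := 0)).mul_const v).cexp
    simpa using this.hasDerivWithinAt (s := Ici 0)
  refine (uniqueDiffOn_Ici (0 : ℝ) 0 self_mem_Ici).eq_deriv _ (d z) ((d w).congr ?_ ?_)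
  · intro t ht
    exact h ⟨t, ht⟩
  · simp

/-- A continuous multiplicative function on the half-line is an exponential. -/
theorem exists_exp_of_mul (F : ℝ → ℂ) (hF : Continuous F) (h0 : F 0 = 1)
    (hm : ∀ s t, 0 ≤ s → 0 ≤ t → F (s + t) = F s * F t) :
    ∃ z : ℂ, ∀ t, 0 ≤ t → F t = cexp (t * z) := by
  set G : ℝ → ℂ := fun x => ∫ s in (0 : ℝ)..x, F s with hG
  have dG : ∀ x, HasDerivAt G (F x) x := fun x => hF.integral_hasStrictDerivAt 0 x |>.hasDerivAt
  obtain ⟨a, ha, hc⟩ : ∃ a, 0 < a ∧ G a ≠ 0 := by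
    by_contra! H
    have h1 : HasDerivWithinAt G 0 (Ici 0) 0 := by
      refine (hasDerivWithinAt_const (0 : ℝ) (Ici 0) (0 : ℂ)).congr ?_ (by simp [hG])
      intro x hx
      rcases eq_or_lt_of_le (show (0 : ℝ) ≤ x from hx) with rfl | hx
      · simp [hG]
      · exact H x hx
    have := (uniqueDiffOn_Ici (0 : ℝ) 0 self_mem_Ici).eq_deriv _ h1 (dG 0).hasDerivWithinAt
    rw [h0] at this
    exact zero_ne_one this
  have hK : ∀ t, 0 ≤ t → F t = (G (t + a) - G t) / G a := by
    intro t ht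
    rw [eq_div_iff hc]
    have e1 : G (t + a) - G t = ∫ s in t..(t + a), F s :=
      intervalIntegral.integral_interval_sub_left (hF.intervalIntegrable _ _)
        (hF.intervalIntegrable _ _)
    have e2 : ∫ s in t..(t + a), F s = ∫ s in (0 : ℝ)..a, F (t + s) := by
      rw [intervalIntegral.integral_comp_add_left (fun s => F s) t]; simp
    rw [e1, e2, hG, ← intervalIntegral.integral_const_mul]
    refine intervalIntegral.integral_congr fun s hs => ?_
    rw [uIcc_of_le ha.le] at hs
    exact (hm t s ht hs.1).symm
  set z : ℂ := (F a - 1) / G a with hz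
  refine ⟨z, fun t ht => ?_⟩
  set K : ℝ → ℂ := fun t => (G (t + a) - G t) / G a with hKd
  have dK : ∀ t, 0 ≤ t → HasDerivAt K (z * K t) t := by
    intro t ht
    have h1 := (((dG (t + a)).comp_add_const t a).sub (dG t)).div_const (G a)
    have e : z * K t = (F (t + a) - F t) / G a := by
      rw [show K t = F t from (hK t ht).symm, hm t a ht ha.le, hz]
      ring
    rw [e]
    exact h1
  have dE : ∀ s, 0 ≤ s → HasDerivAt (fun s : ℝ => K s * cexp (-(s * z))) 0 s := by
    intro s hs
    have h1 : HasDerivAt (fun s : ℝ => cexp (-(s * z))) (cexp (-(s * z)) * -(1 * z)) s :=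
      (((Complex.ofRealCLM.hasDerivAt (x := s)).mul_const z).neg).cexp
    have h2 := (dK s hs).mul h1
    have e : z * K s * cexp (-(s * z)) + K s * (cexp (-(s * z)) * -(1 * z)) = 0 := by ring
    rw [e] at h2
    exact h2
  have hconst := constant_of_has_deriv_right_zero (a := 0) (b := t)
    (f := fun s : ℝ => K s * cexp (-(s * z)))
    (fun s hs => (dE s hs.1).continuousAt.continuousWithinAt)
    (fun s hs => (dE s hs.1).hasDerivWithinAt) t ⟨ht, le_rfl⟩
  have hK0 : K 0 = 1 := by rw [← h0]; exact (hK 0 le_rfl).symm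
  rw [hK0, Complex.exp_neg, ← div_eq_mul_inv, div_eq_iff (Complex.exp_ne_zero _)] at hconst
  rw [hK t ht]
  simpa using hconst

/-- For a Lévy process the characteristic exponent exists. -/
theorem exists_exponent {Ω : Type*} [MeasurableSpace Ω] {P : Measure Ω} [IsProbabilityMeasure P]
    {L : ℝ≥0 → Ω → ℝ} (hL : IsLevyProcess P L) (u : ℝ) :
    ∃ z : ℂ, ∀ t : ℝ≥0, ∫ ω, cexp (I * u * L t ω) ∂P = cexp (t * z) := by
  have hcf : ∀ t, ∫ ω, cexp (I * u * L t ω) ∂P = charFun (P.map (L t)) u := by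
    intro t
    rw [charFun_apply_real, integral_map (hL.measurable t).aemeasurable
      (by fun_prop)]
    refine integral_congr_ae (Eventually.of_forall fun ω => ?_)
    simp only
    congr 1
    ring
  have hcont : Continuous fun t => charFun (P.map (L t)) u := by
    rw [continuous_iff_continuousAt]
    intro t
    refine tendsto_of_seq_tendsto fun x hx => ?_
    have h : TendstoInDistribution (fun n => L (x n)) atTop (L t) (fun _ => P) P :=
      TendstoInMeasure.tendstoInDistribution (fun ε hε => (hL.stochCont t ε hε).comp hx)
        fun n => (hL.measurable (x n)).aemeasurable
    exact ProbabilityMeasure.tendsto_iff_tendsto_charFun.1 h.tendsto u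
  have hmul : ∀ s t, charFun (P.map (L (s + t))) u
      = charFun (P.map (L s)) u * charFun (P.map (L t)) u := by
    intro s t
    have hi := hL.indep.indepFun_eval_sub (zero_le (a := s)) (le_self_add : s ≤ s + t) hL.zero
    have e : L (s + t) = L s + (L (s + t) - L s) := by simp
    have e2 : P.map (L (s + t) - L s) = P.map (L t) := by
      refine (hL.stationary s t).trans (Measure.map_congr ?_)
      filter_upwards [hL.zero] with ω hω
      simp [hω]
    rw [e, hi.charFun_map_add_eq_mul (hL.measurable s).aemeasurable
      ((hL.measurable _).sub (hL.measurable s)).aemeasurable, Pi.mul_apply, e2]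
  have h0 : charFun (P.map (L 0)) u = 1 := by
    rw [← hcf]
    have : ∀ᵐ ω ∂P, cexp (I * u * L 0 ω) = 1 := by
      filter_upwards [hL.zero] with ω hω
      simp [hω]
    rw [integral_congr_ae this]
    simp
  obtain ⟨z, hz⟩ := exists_exp_of_mul (fun t : ℝ => charFun (P.map (L t.toNNReal)) u)
    (hcont.comp continuous_real_toNNReal) (by simpa using h0) (fun s t hs ht => by
      simp only [Real.toNNReal_add hs ht]; exact hmul _ _)
  exact ⟨z, fun t => by simpa [hcf] using hz t t.2⟩

/-- The defining property of the characteristic exponent of a Lévy process. -/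
theorem charFun_eq_exp {Ω : Type*} [MeasurableSpace Ω] {P : Measure Ω} [IsProbabilityMeasure P]
    {L : ℝ≥0 → Ω → ℝ} (hL : IsLevyProcess P L) (u : ℝ) (t : ℝ≥0) :
    ∫ ω, cexp (I * u * L t ω) ∂P = cexp (t * exponent P L u) := by
  have h := exists_exponent hL u
  rw [exponent, dif_pos h]
  exact h.choose_spec t

end LevyPoisson

/-!
Write `P_t` for the transition operators of the dual process `-L` and `η` for the exponent of `L`.
The candidate `H` is the inverse Fourier integral of `ĝ / η`; it lies in `C₀(ℝ)` by the
Riemann–Lebesgue lemma (`fourierInvC0`).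

On `L¹` functions `P_t` acts as multiplication by `e^{t η}` on the Fourier side, so that by Fubini
and Fourier inversion a time average `∫ w(s) P_s g ds` is the inverse Fourier integral of
`ĝ ∫ w(s) e^{s η} ds`, provided the latter is integrable (`IsLevyProcess.integral_transition_eq`).
The zeros of `η` form a null set (`IsLevyProcess.ae_exponent_ne_zero`), which makes two cases useful:

* `w(s) = e^{-qs}` represents the resolvent `U^q g` through `ĝ / (q - η)`. Since `Re η ≤ 0`, this is
  dominated by `|ĝ / η|`, and dominated convergence gives `-U^q g → H` uniformly as `q ↓ 0`. As the
  functions `U^q g` are real, so is the inverse Fourier integral of `ĝ / η`.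
* `w = 1` on `(0, t]` represents `∫_0^t P_s g ds` through `ĝ (e^{t η} - 1) / η`, and the same function
  represents `P_t H - H` (`IsLevyProcess.transition_sub_eq_setIntegral`). Strong continuity of `P_t`
  at `0` then yields that the generator maps `H` to `g`.

For uniqueness, a function `f ∈ C₀(ℝ)` annihilated by the generator satisfies `P_t f = f` for all
`t`. If `f` or `-f` has a positive maximum, the maximum is attained on a compact set which is
invariant under almost all translations by `-L_t`; looking at the largest and the smallest point of
this set, one sees that `L_t = 0` almost surely (`ae_eq_zero_of_translateAverage_eq`), which is
excluded.
-/

namespace LevyPoisson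

/-! ### Fourier transforms on the line -/

theorem norm_cexp_I_mul_mul (x y : ℝ) : ‖cexp (I * x * y)‖ = 1 := by
  rw [show I * x * y = ((x * y : ℝ) : ℂ) * I by push_cast; ring, norm_exp_ofReal_mul_I]

theorem norm_cexp_neg_I_mul_mul (x y : ℝ) : ‖cexp (-(I * x * y))‖ = 1 := by
  rw [show -(I * x * y) = ((-(x * y) : ℝ) : ℂ) * I by push_cast; ring, norm_exp_ofReal_mul_I]

theorem integrable_mul_cexp {h : ℝ → ℂ} (hh : Integrable h) (x : ℝ) :
    Integrable fun ξ : ℝ => h ξ * cexp (-(I * x * ξ)) :=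
  hh.mul_bdd (c := 1) (by fun_prop) (Eventually.of_forall fun ξ => (norm_cexp_neg_I_mul_mul x ξ).le)

/-- The inverse Fourier integral `(2π)⁻¹ ∫ h(ξ) e^{-i x ξ} dξ`. -/
noncomputable def fourierInvIntegral (h : ℝ → ℂ) (x : ℝ) : ℂ :=
  1 / (2 * Real.pi) * ∫ ξ : ℝ, h ξ * cexp (-(I * x * ξ))

theorem fourierInvIntegral_eq_fourier (h : ℝ → ℂ) (x : ℝ) :
    fourierInvIntegral h x =
      1 / (2 * Real.pi) * FourierTransform.fourier h (x / (2 * Real.pi)) := by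
  rw [fourierInvIntegral, Real.fourier_real_eq_integral_exp_smul]
  congr 1
  refine integral_congr_ae (Eventually.of_forall fun ξ => ?_)
  simp only [smul_eq_mul]
  rw [mul_comm]
  congr 2
  have : (Real.pi : ℂ) ≠ 0 := by exact_mod_cast Real.pi_ne_zero
  push_cast
  field_simp

theorem fourierInvIntegral_congr {h k : ℝ → ℂ} (e : h =ᵐ[volume] k) (x : ℝ) :
    fourierInvIntegral h x = fourierInvIntegral k x := by
  rw [fourierInvIntegral, fourierInvIntegral]
  congr 1
  refine integral_congr_ae ?_
  filter_upwards [e] with ξ hξ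
  rw [hξ]

theorem fourierInvIntegral_sub {h k : ℝ → ℂ} (hh : Integrable h) (hk : Integrable k) (x : ℝ) :
    fourierInvIntegral (fun ξ => h ξ - k ξ) x = fourierInvIntegral h x - fourierInvIntegral k x := by
  rw [fourierInvIntegral, fourierInvIntegral, fourierInvIntegral, ← mul_sub,
    ← integral_sub (integrable_mul_cexp hh x) (integrable_mul_cexp hk x)]
  simp only [sub_mul]

theorem norm_fourierInvIntegral_le (h : ℝ → ℂ) (x : ℝ) :
    ‖fourierInvIntegral h x‖ ≤ 1 / (2 * Real.pi) * ∫ ξ : ℝ, ‖h ξ‖ := by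
  rw [fourierInvIntegral, norm_mul]
  have e : ‖(1 / (2 * Real.pi) : ℂ)‖ = 1 / (2 * Real.pi) := by
    simp [abs_of_pos Real.pi_pos]
  rw [e]
  refine mul_le_mul_of_nonneg_left ((norm_integral_le_integral_norm _).trans_eq ?_)
    (by positivity)
  simp only [norm_mul, norm_cexp_neg_I_mul_mul, mul_one]

theorem continuous_fourierInvIntegral {h : ℝ → ℂ} (hh : Integrable h) :
    Continuous (fourierInvIntegral h) := by
  refine continuous_const.mul (continuous_of_dominated (bound := fun ξ => ‖h ξ‖) ?_ ?_ hh.norm ?_)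
  · exact fun x => (integrable_mul_cexp hh x).aestronglyMeasurable
  · intro x
    exact Eventually.of_forall fun ξ => by rw [norm_mul, norm_cexp_neg_I_mul_mul, mul_one]
  · exact Eventually.of_forall fun ξ => by fun_prop

theorem tendsto_fourierInvIntegral_cocompact (h : ℝ → ℂ) :
    Tendsto (fourierInvIntegral h) (cocompact ℝ) (𝓝 0) := by
  have h1 : Tendsto (fun x : ℝ => x / (2 * Real.pi)) (cocompact ℝ) (cocompact ℝ) :=
    (Homeomorph.mulRight₀ _ (inv_ne_zero Real.two_pi_pos.ne')).isClosedEmbedding.tendsto_cocompact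
  have h2 := ((Real.zero_at_infty_fourier h).comp h1).const_mul (1 / (2 * Real.pi) : ℂ)
  rw [mul_zero] at h2
  exact h2.congr fun x => (fourierInvIntegral_eq_fourier h x).symm

/-- The real part of the inverse Fourier integral of an integrable function, as an element of
`C₀(ℝ)`: it vanishes at infinity by the Riemann–Lebesgue lemma. -/
noncomputable def fourierInvC0 (h : ℝ → ℂ) (hh : Integrable h) : C₀(ℝ, ℝ) where
  toFun x := (fourierInvIntegral h x).re
  continuous_toFun := continuous_re.comp (continuous_fourierInvIntegral hh)
  zero_at_infty' := by
    have := (continuous_re.tendsto 0).comp (tendsto_fourierInvIntegral_cocompact h)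
    rwa [Complex.zero_re] at this

theorem fourierInvC0_apply (h : ℝ → ℂ) (hh : Integrable h) (x : ℝ) :
    fourierInvC0 h hh x = (fourierInvIntegral h x).re := rfl

theorem norm_le_of_forall_apply_le {f : C₀(ℝ, ℝ)} {C : ℝ} (hC : 0 ≤ C) (h : ∀ x, |f x| ≤ C) :
    ‖f‖ ≤ C := by
  rw [← ZeroAtInftyContinuousMap.norm_toBCF_eq_norm, BoundedContinuousFunction.norm_le hC]
  exact h

theorem abs_apply_le_norm (f : C₀(ℝ, ℝ)) (x : ℝ) : |f x| ≤ ‖f‖ :=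
  f.toBCF.norm_coe_le_norm x

/-- Fourier inversion for the normalisation used in `fourierHat`. -/
theorem fourierInvIntegral_fourierHat {f : ℝ → ℝ} (hc : Continuous f) (hf : Integrable f)
    (hF : Integrable (fourierHat f)) (x : ℝ) : fourierInvIntegral (fourierHat f) x = f x := by
  have hπ : (Real.pi : ℂ) ≠ 0 := by exact_mod_cast Real.pi_ne_zero
  -- `fourierHat f ξ = 𝓕 f (c ξ)` for Mathlib's transform, whose kernel is `e^{-2π i x ξ}`.
  set c : ℝ := -(2 * Real.pi)⁻¹ with hcd
  have hc0 : c ≠ 0 := neg_ne_zero.2 (inv_ne_zero Real.two_pi_pos.ne')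
  have e1 : ∀ ξ, fourierHat f ξ = FourierTransform.fourier (fun x => (f x : ℂ)) (c * ξ) := by
    intro ξ
    rw [fourierHat, Real.fourier_real_eq_integral_exp_smul]
    refine integral_congr_ae (Eventually.of_forall fun y => ?_)
    simp only [smul_eq_mul]
    rw [mul_comm]
    congr 2
    rw [hcd]
    push_cast
    field_simp
  have hF' : Integrable (FourierTransform.fourier fun x => (f x : ℂ)) := by
    rw [← integrable_comp_mul_left_iff _ hc0]
    exact hF.congr (Eventually.of_forall e1)
  have key := congrFun (Continuous.fourierInv_fourier_eq
    (continuous_ofReal.comp hc) hf.ofReal hF') x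
  simp only [Function.comp_apply] at key
  rw [← key, Real.fourierInv_eq', fourierInvIntegral]
  have e2 := Measure.integral_comp_mul_left (fun v : ℝ =>
    cexp ((2 * Real.pi * (inner ℝ v x) : ℝ) * I) •
      FourierTransform.fourier (fun x => (f x : ℂ)) v) c
  have e3 : ((|c⁻¹| : ℝ) : ℂ) = 2 * Real.pi := by
    rw [hcd, inv_neg, inv_inv, abs_neg, abs_of_pos Real.two_pi_pos]
    push_cast
    rfl
  rw [real_smul, e3] at e2
  have e4 : ∫ ξ : ℝ, fourierHat f ξ * cexp (-(I * x * ξ)) = ∫ ξ : ℝ,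
      cexp ((2 * Real.pi * (inner ℝ (c * ξ) x) : ℝ) * I) •
      FourierTransform.fourier (fun x => (f x : ℂ)) (c * ξ) := by
    refine integral_congr_ae (Eventually.of_forall fun ξ => ?_)
    simp only [smul_eq_mul, e1, RCLike.inner_apply, conj_trivial]
    rw [mul_comm]
    congr 2
    rw [hcd]
    push_cast
    field_simp
  rw [e4, e2, ← mul_assoc, one_div, inv_mul_cancel₀ (by simp), one_mul]
  rfl

variable {Ω : Type*} [MeasurableSpace Ω] {P : Measure Ω} [IsProbabilityMeasure P]
  {L : ℝ≥0 → Ω → ℝ}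

/-! ### The characteristic exponent -/

theorem IsLevyProcess.charFun_map (hL : IsLevyProcess P L) (t : ℝ≥0) (u : ℝ) :
    charFun (P.map (L t)) u = cexp (t * exponent P L u) := by
  rw [← charFun_eq_exp hL, charFun_apply_real, integral_map (hL.measurable t).aemeasurable
    (by fun_prop)]
  refine integral_congr_ae (Eventually.of_forall fun ω => ?_)
  simp only
  congr 1
  ring

theorem IsLevyProcess.norm_cexp_exponent_le (hL : IsLevyProcess P L) (t : ℝ≥0) (u : ℝ) :
    ‖cexp (t * exponent P L u)‖ ≤ 1 := by
  have := Measure.isProbabilityMeasure_map (μ := P) (hL.measurable t).aemeasurable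
  rw [← hL.charFun_map]
  exact norm_charFun_le_one u

theorem IsLevyProcess.exponent_re_nonpos (hL : IsLevyProcess P L) (u : ℝ) :
    (exponent P L u).re ≤ 0 := by
  have h := hL.norm_cexp_exponent_le 1 u
  rw [NNReal.coe_one, ofReal_one, one_mul, Complex.norm_exp] at h
  exact Real.exp_le_one_iff.1 h

/-- The exponent is the derivative at `t = 0` of the characteristic functions of `L_t`, hence a
limit of measurable functions. -/
theorem IsLevyProcess.measurable_exponent (hL : IsLevyProcess P L) :
    Measurable (exponent P L) := by
  have hu : Tendsto (fun n : ℕ => ((n : ℝ) + 1)⁻¹) atTop (𝓝[>] 0) :=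
    tendsto_inv_atTop_nhdsGT_zero.comp
      (tendsto_atTop_add_const_right _ 1 tendsto_natCast_atTop_atTop)
  refine measurable_of_tendsto_metrizable
    (f := fun (n : ℕ) u => (((n : ℝ) + 1)⁻¹)⁻¹ •
      (charFun (P.map (L (((n : ℝ) + 1)⁻¹).toNNReal)) u - 1)) ?_ ?_
  · intro n
    exact (measurable_charFun.sub_const 1).const_smul (((n : ℝ) + 1)⁻¹)⁻¹
  · rw [tendsto_pi_nhds]
    intro u
    have d : HasDerivAt (fun t : ℝ => cexp (t * exponent P L u)) (exponent P L u) 0 := by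
      simpa using ((Complex.ofRealCLM.hasDerivAt (x := 0)).mul_const (exponent P L u)).cexp
    refine (d.tendsto_slope_zero_right.comp hu).congr fun n => ?_
    have hr : 0 ≤ ((n : ℝ) + 1)⁻¹ := by positivity
    simp [hL.charFun_map, Real.coe_toNNReal _ hr]

/-- The exponent vanishes at `u` exactly when `u L_t ∈ 2πℤ` almost surely for all `t`. -/
theorem IsLevyProcess.exponent_eq_zero_iff (hL : IsLevyProcess P L) (u : ℝ) :
    exponent P L u = 0 ↔ ∀ t, ∀ᵐ ω ∂P, Real.cos (u * L t ω) = 1 := by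
  have hre : ∀ t ω, (cexp (I * u * L t ω)).re = Real.cos (u * L t ω) := by
    intro t ω
    rw [show I * u * L t ω = ((u * L t ω : ℝ) : ℂ) * I by push_cast; ring, exp_ofReal_mul_I_re]
  have him : ∀ t ω, (cexp (I * u * L t ω)).im = Real.sin (u * L t ω) := by
    intro t ω
    rw [show I * u * L t ω = ((u * L t ω : ℝ) : ℂ) * I by push_cast; ring, exp_ofReal_mul_I_im]
  have hm : ∀ t, Measurable (L t) := hL.measurable
  have hint : ∀ t, Integrable (fun ω => cexp (I * u * L t ω)) P := fun t => by
    have := hm t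
    exact Integrable.of_bound (by fun_prop) 1
      (Eventually.of_forall fun ω => (norm_cexp_I_mul_mul u (L t ω)).le)
  constructor
  · intro h t
    have h1 := charFun_eq_exp hL u t
    rw [h, mul_zero, Complex.exp_zero] at h1
    have h2 := congrArg re h1
    rw [← RCLike.re_eq_complex_re, ← integral_re (hint t), RCLike.re_eq_complex_re] at h2
    simp only [hre, one_re] at h2
    have hcos : Integrable (fun ω => Real.cos (u * L t ω)) P :=
      (hint t).re.congr (Eventually.of_forall fun ω => hre t ω)
    have h3 : ∫ ω, (1 - Real.cos (u * L t ω)) ∂P = 0 := by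
      rw [integral_sub (integrable_const _) hcos, h2]; simp
    rw [integral_eq_zero_iff_of_nonneg (fun ω => sub_nonneg.2 (Real.cos_le_one _))
      ((integrable_const _).sub hcos)] at h3
    filter_upwards [h3] with ω hω
    simp only [Pi.zero_apply] at hω
    linarith
  · intro h
    refine exponent_unique fun t => ?_
    rw [← charFun_eq_exp hL, mul_zero, Complex.exp_zero]
    have : ∀ᵐ ω ∂P, cexp (I * u * L t ω) = 1 := by
      filter_upwards [h t] with ω hω
      refine Complex.ext ?_ ?_
      · rw [hre, hω, one_re]
      · rw [him, one_im]
        nlinarith [Real.sin_sq_add_cos_sq (u * L t ω)]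
    rw [integral_congr_ae this]
    simp

/-- The zeros of the exponent, as a subgroup of the line. -/
def IsLevyProcess.exponentZeros (hL : IsLevyProcess P L) : AddSubgroup ℝ where
  carrier := {u | exponent P L u = 0}
  zero_mem' := by
    rw [mem_ofPred_eq, hL.exponent_eq_zero_iff]
    simp
  add_mem' := by
    intro u v hu hv
    rw [mem_ofPred_eq, hL.exponent_eq_zero_iff] at *
    intro t
    filter_upwards [hu t, hv t] with ω h1 h2
    have h3 : Real.sin (u * L t ω) = 0 := by
      nlinarith [Real.sin_sq_add_cos_sq (u * L t ω)]
    rw [add_mul, Real.cos_add, h1, h2, h3]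
    ring
  neg_mem' := by
    intro u hu
    rw [mem_ofPred_eq, hL.exponent_eq_zero_iff] at *
    simpa using hu

/-- The zeros of the exponent form a measurable subgroup; if it had positive measure, it would
contain a neighbourhood of `0` by Steinhaus' theorem and hence be the whole line. -/
theorem IsLevyProcess.ae_exponent_ne_zero (hL : IsLevyProcess P L)
    (hnontriv : ¬ ∀ t : ℝ≥0, ∀ᵐ ω ∂P, L t ω = 0) : ∀ᵐ u : ℝ, exponent P L u ≠ 0 := by
  by_contra hcon
  have hZ : MeasurableSet {u | exponent P L u = 0} :=
    hL.measurable_exponent (measurableSet_singleton 0)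
  have hpos : 0 < volume {u | exponent P L u = 0} := by
    rw [pos_iff_ne_zero]
    intro h
    exact hcon (by simpa [ae_iff] using h)
  have hnhds := Measure.sub_mem_nhds_zero_of_addHaar_pos volume _ hZ hpos
  have hopen : IsOpen (hL.exponentZeros : Set ℝ) := by
    refine AddSubgroup.isOpen_of_mem_nhds _ (g := 0) (mem_of_superset hnhds ?_)
    rintro _ ⟨u, hu, v, hv, rfl⟩
    exact hL.exponentZeros.sub_mem hu hv
  have huniv : (hL.exponentZeros : Set ℝ) = univ :=
    IsClopen.eq_univ ⟨AddSubgroup.isClosed_of_isOpen _ hopen, hopen⟩ ⟨0, zero_mem _⟩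
  refine hnontriv fun t => ?_
  have hd : P.map (L t) = Measure.dirac 0 := by
    have := Measure.isProbabilityMeasure_map (μ := P) (hL.measurable t).aemeasurable
    refine Measure.ext_of_charFun (funext fun u => ?_)
    have hu : exponent P L u = 0 := by
      have : u ∈ (hL.exponentZeros : Set ℝ) := huniv ▸ mem_univ u
      exact this
    rw [hL.charFun_map, hu, charFun_dirac]
    simp
  have : ∀ᵐ x ∂(P.map (L t)), x = 0 := by
    rw [hd, ae_dirac_eq]
    simp
  exact ae_of_ae_map (hL.measurable t).aemeasurable this

/-! ### The transition semigroup of the dual process -/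

omit [IsProbabilityMeasure P] in
theorem IsLevyProcess.measurable_dual (hL : IsLevyProcess P L) (t : ℝ≥0) :
    Measurable (dual L t) := (hL.measurable t).neg

theorem IsLevyProcess.isProbabilityMeasure_map_dual (hL : IsLevyProcess P L) (t : ℝ≥0) :
    IsProbabilityMeasure (P.map (dual L t)) :=
  Measure.isProbabilityMeasure_map (hL.measurable_dual t).aemeasurable

theorem integrable_comp_add (μ : Measure ℝ) [IsFiniteMeasure μ] (f : C₀(ℝ, ℝ)) (x : ℝ) :
    Integrable (fun y => f (y + x)) μ :=
  Integrable.of_bound (f.continuous.comp (continuous_add_const x)).aestronglyMeasurable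
    ‖f‖ (Eventually.of_forall fun y => abs_apply_le_norm f (y + x))

theorem transition_eq_integral_map (X : ℝ≥0 → Ω → ℝ) (t : ℝ≥0) (f : C₀(ℝ, ℝ)) (x : ℝ) :
    transition P X t f x = ∫ y, f (y + x) ∂(P.map (X t)) := rfl

theorem IsLevyProcess.norm_transition_le (hL : IsLevyProcess P L) (t : ℝ≥0) (f : C₀(ℝ, ℝ)) :
    ‖transition P (dual L) t f‖ ≤ ‖f‖ := by
  have := hL.isProbabilityMeasure_map_dual t
  refine norm_le_of_forall_apply_le (norm_nonneg _) fun x => ?_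
  rw [transition_eq_integral_map]
  rw [← Real.norm_eq_abs]
  refine (norm_integral_le_of_norm_le_const (C := ‖f‖)
    (Eventually.of_forall fun y => abs_apply_le_norm f (y + x))).trans_eq ?_
  simp

/-- Strong continuity, from stochastic continuity of the process and uniform continuity of `f`. -/
theorem IsLevyProcess.continuous_transition (hL : IsLevyProcess P L) (f : C₀(ℝ, ℝ)) :
    Continuous fun t => transition P (dual L) t f := by
  rw [continuous_iff_continuousAt]
  intro t
  rw [ContinuousAt, Metric.tendsto_nhds]
  intro ε hε
  obtain ⟨δ, hδ, hδf⟩ := Metric.uniformContinuous_iff.1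
    (ZeroAtInftyContinuousMap.uniformContinuous f) (ε / 2) (half_pos hε)
  have hst := (tendstoInMeasure_iff_measureReal_dist.1 (hL.stochCont t) δ hδ).const_mul (2 * ‖f‖)
  rw [mul_zero] at hst
  filter_upwards [hst.eventually (gt_mem_nhds (half_pos (half_pos hε)))] with s hs
  rw [dist_eq_norm]
  set A : Set Ω := {ω | δ ≤ dist (L s ω) (L t ω)} with hA
  have hAm : MeasurableSet A :=
    measurableSet_le measurable_const ((hL.measurable s).dist (hL.measurable t))
  have hi : ∀ (r : ℝ≥0) (x : ℝ), Integrable (fun ω => f (dual L r ω + x)) P := fun r x =>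
    (integrable_comp_add (P.map (dual L r)) f x).comp_measurable (hL.measurable_dual r)
  refine (norm_le_of_forall_apply_le (C := ε / 2 + ε / 4) (by positivity) fun x => ?_).trans_lt
    (by linarith)
  rw [ZeroAtInftyContinuousMap.sub_apply,
    transition_apply P _ s (hL.measurable_dual s).aemeasurable,
    transition_apply P _ t (hL.measurable_dual t).aemeasurable, ← integral_sub (hi s x) (hi t x)]
  -- Off `A` the two values are `ε / 2`-close, and `2 ‖f‖ P(A) < ε / 4`.
  have hb : ∀ ω, ‖f (dual L s ω + x) - f (dual L t ω + x)‖
      ≤ ε / 2 + A.indicator (fun _ => 2 * ‖f‖) ω := by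
    intro ω
    by_cases hω : ω ∈ A
    · rw [indicator_of_mem hω]
      have := norm_sub_le (f (dual L s ω + x)) (f (dual L t ω + x))
      have h1 := abs_apply_le_norm f (dual L s ω + x)
      have h2 := abs_apply_le_norm f (dual L t ω + x)
      rw [← Real.norm_eq_abs] at h1 h2
      linarith
    · rw [indicator_of_notMem hω, add_zero, ← dist_eq_norm]
      refine (hδf ?_).le
      rw [dist_add_right]
      simpa [hA, dual] using hω
  have hAi : Integrable (A.indicator fun _ => 2 * ‖f‖) P :=
    (integrable_const _).indicator hAm
  refine (norm_integral_le_of_norm_le ((integrable_const _).add hAi)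
    (Eventually.of_forall hb)).trans ?_
  simp only [Pi.add_apply]
  rw [integral_add (integrable_const _) hAi, integral_indicator_const _ hAm, integral_const,
    smul_eq_mul, smul_eq_mul, probReal_univ, mul_comm (P.real A)]
  linarith

theorem IsLevyProcess.transition_zero (hL : IsLevyProcess P L) (f : C₀(ℝ, ℝ)) :
    transition P (dual L) 0 f = f := by
  ext x
  rw [transition_apply P _ 0 (hL.measurable_dual 0).aemeasurable]
  have : ∀ᵐ ω ∂P, f (dual L 0 ω + x) = f x := by
    filter_upwards [hL.zero] with ω hω
    simp [dual, hω]
  rw [integral_congr_ae this]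
  simp

theorem IsLevyProcess.map_dual_add (hL : IsLevyProcess P L) (s t : ℝ≥0) :
    P.map (dual L (s + t)) = P.map (dual L s) ∗ P.map (dual L t) := by
  have := fun r => Measure.isProbabilityMeasure_map (μ := P) (hL.measurable r).aemeasurable
  have := hL.isProbabilityMeasure_map_dual
  refine Measure.ext_of_charFun (funext fun u => ?_)
  have h : ∀ r : ℝ≥0, charFun (P.map (dual L r)) u = cexp (r * exponent P L (-u)) := by
    intro r
    rw [← hL.charFun_map, charFun_apply_real, charFun_apply_real,
      integral_map (hL.measurable r).aemeasurable (by fun_prop),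
      integral_map (hL.measurable_dual r).aemeasurable (by fun_prop)]
    simp [dual]
  rw [charFun_conv, h, h, h, ← Complex.exp_add]
  push_cast
  ring_nf

theorem IsLevyProcess.transition_add (hL : IsLevyProcess P L) (s t : ℝ≥0) (f : C₀(ℝ, ℝ)) :
    transition P (dual L) (s + t) f = transition P (dual L) s (transition P (dual L) t f) := by
  have := hL.isProbabilityMeasure_map_dual
  ext x
  rw [transition_eq_integral_map, transition_eq_integral_map, hL.map_dual_add,
    integral_conv (integrable_comp_add _ f x)]
  refine integral_congr_ae (Eventually.of_forall fun y => ?_)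
  simp only
  rw [transition_eq_integral_map]
  refine integral_congr_ae (Eventually.of_forall fun z => ?_)
  simp only
  congr 1
  ring

/-! ### Fourier transforms of transition operators and of their time averages -/

/-- The law of `-L_t` has characteristic function `e^{t η(ξ)}` at `-ξ`. -/
theorem IsLevyProcess.integral_cexp_dual (hL : IsLevyProcess P L) (t : ℝ≥0) (ξ : ℝ) :
    ∫ y, cexp (-(I * ξ * y)) ∂(P.map (dual L t)) = cexp (t * exponent P L ξ) := by
  rw [← charFun_eq_exp hL, integral_map (hL.measurable_dual t).aemeasurable (by fun_prop)]
  simp [dual]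

theorem integrable_comp_add_prod (μ : Measure ℝ) [IsFiniteMeasure μ] {g : ℝ → ℝ}
    (hc : Continuous g) (hg : Integrable g) :
    Integrable (fun p : ℝ × ℝ => g (p.1 + p.2)) (μ.prod volume) := by
  rw [integrable_prod_iff (by fun_prop)]
  refine ⟨Eventually.of_forall fun y => hg.comp_add_left y, ?_⟩
  simp only [integral_add_left_eq_self fun x => ‖g x‖]
  exact integrable_const _

theorem IsLevyProcess.integrable_transition (hL : IsLevyProcess P L) (t : ℝ≥0) (g : C₀(ℝ, ℝ))
    (hg : Integrable fun x => g x) : Integrable fun x => transition P (dual L) t g x := by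
  have := hL.isProbabilityMeasure_map_dual t
  exact (integrable_comp_add_prod (P.map (dual L t)) g.continuous hg).integral_prod_right

theorem IsLevyProcess.integral_norm_transition_le (hL : IsLevyProcess P L) (t : ℝ≥0)
    (g : C₀(ℝ, ℝ)) (hg : Integrable fun x => g x) :
    ∫ x, ‖transition P (dual L) t g x‖ ≤ ∫ x, ‖g x‖ := by
  have := hL.isProbabilityMeasure_map_dual t
  have hp := integrable_comp_add_prod (P.map (dual L t)) g.continuous hg
  calc ∫ x, ‖transition P (dual L) t g x‖
      ≤ ∫ x, ∫ y, ‖g (y + x)‖ ∂(P.map (dual L t)) := by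
        refine integral_mono (hL.integrable_transition t g hg).norm hp.norm.integral_prod_right
          fun x => ?_
        exact norm_integral_le_integral_norm _
    _ = ∫ y, (∫ x, ‖g (y + x)‖) ∂(P.map (dual L t)) :=
        (integral_integral_swap (f := fun y x => ‖g (y + x)‖) hp.norm).symm
    _ = ∫ x, ‖g x‖ := by
        simp only [integral_add_left_eq_self fun x => ‖g x‖]
        simp

theorem fourierHat_comp_add_left (g : ℝ → ℝ) (y ξ : ℝ) :
    fourierHat (fun x => g (y + x)) ξ = cexp (-(I * ξ * y)) * fourierHat g ξ := by
  rw [fourierHat, fourierHat, ← integral_const_mul,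
    ← integral_add_left_eq_self (μ := volume)
      (fun x : ℝ => cexp (-(I * ξ * y)) * ((g x : ℂ) * cexp (I * ξ * x))) y]
  refine integral_congr_ae (Eventually.of_forall fun x => ?_)
  simp only
  rw [mul_left_comm, ← Complex.exp_add]
  congr 2
  push_cast
  ring

theorem integrable_ofReal_mul_cexp {α : Type*} [MeasurableSpace α] {μ : Measure α} {f : α → ℝ}
    (hf : Integrable f μ) {u : α → ℝ} (hu : Measurable u) (ξ : ℝ) :
    Integrable (fun a => (f a : ℂ) * cexp (I * ξ * u a)) μ :=
  hf.ofReal.mul_bdd (c := 1) (by fun_prop)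
    (Eventually.of_forall fun a => (norm_cexp_I_mul_mul ξ (u a)).le)

theorem IsLevyProcess.fourierHat_transition (hL : IsLevyProcess P L) (t : ℝ≥0) (g : C₀(ℝ, ℝ))
    (hg : Integrable fun x => g x) (ξ : ℝ) :
    fourierHat (transition P (dual L) t g) ξ = cexp (t * exponent P L ξ) * fourierHat g ξ := by
  have := hL.isProbabilityMeasure_map_dual t
  have hp := integrable_ofReal_mul_cexp (u := Prod.snd)
    (integrable_comp_add_prod (P.map (dual L t)) g.continuous hg) measurable_snd ξ
  calc fourierHat (transition P (dual L) t g) ξ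
      = ∫ x : ℝ, ∫ y, (g (y + x) : ℂ) * cexp (I * ξ * x) ∂(P.map (dual L t)) := by
        refine integral_congr_ae (Eventually.of_forall fun x => ?_)
        simp only
        rw [integral_mul_const, transition_eq_integral_map, integral_complex_ofReal]
    _ = ∫ y, fourierHat (fun x => g (y + x)) ξ ∂(P.map (dual L t)) :=
        (integral_integral_swap (f := fun y (x : ℝ) => (g (y + x) : ℂ) * cexp (I * ξ * x)) hp).symm
    _ = cexp (t * exponent P L ξ) * fourierHat g ξ := by
        simp only [fourierHat_comp_add_left g, integral_mul_const]
        rw [hL.integral_cexp_dual]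

theorem IsLevyProcess.continuous_transition_uncurry (hL : IsLevyProcess P L) (g : C₀(ℝ, ℝ)) :
    Continuous fun p : ℝ × ℝ => transition P (dual L) p.1.toNNReal g p.2 := by
  have h : Continuous fun s : ℝ => (transition P (dual L) s.toNNReal g).toBCF :=
    ZeroAtInftyContinuousMap.isometry_toBCF.continuous.comp
      ((hL.continuous_transition g).comp continuous_real_toNNReal)
  exact (h.comp continuous_fst).eval continuous_snd

/-- Fubini and Fourier inversion: the weighted time average `∫ w(s) P_s g(x) ν(ds)` is integrable
and continuous in `x`, with Fourier transform `ĝ(ξ) ∫ w(s) e^{s η(ξ)} ν(ds)`. If the latter is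
integrable, it can be inverted. The function `k` is a version of it. -/
theorem IsLevyProcess.integral_transition_eq (hL : IsLevyProcess P L) {ν : Measure ℝ} [SFinite ν]
    {w : ℝ → ℝ} (hw : Integrable w ν) (g : C₀(ℝ, ℝ)) (hg : Integrable fun x => g x) {k : ℝ → ℂ}
    (hk : Integrable k)
    (hkg : ∀ᵐ ξ : ℝ, fourierHat g ξ * ∫ s, w s * cexp (s.toNNReal * exponent P L ξ) ∂ν = k ξ)
    (x : ℝ) :
    ((∫ s, w s * transition P (dual L) s.toNNReal g x ∂ν : ℝ) : ℂ) = fourierInvIntegral k x := by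
  set W : ℝ → ℝ := fun x => ∫ s, w s * transition P (dual L) s.toNNReal g x ∂ν with hW
  have hcont := hL.continuous_transition_uncurry g
  have hi : Integrable (fun p : ℝ × ℝ => w p.1 * transition P (dual L) p.1.toNNReal g p.2)
      (ν.prod volume) := by
    have hm : AEStronglyMeasurable
        (fun p : ℝ × ℝ => w p.1 * transition P (dual L) p.1.toNNReal g p.2) (ν.prod volume) :=
      hw.aestronglyMeasurable.comp_fst.mul hcont.aestronglyMeasurable
    rw [integrable_prod_iff hm]
    refine ⟨Eventually.of_forall fun s =>
      (hL.integrable_transition s.toNNReal g hg).const_mul (w s), ?_⟩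
    refine (hw.norm.mul_const (∫ x, ‖g x‖)).mono' hm.norm.integral_prod_right'
      (Eventually.of_forall fun s => ?_)
    simp only [norm_mul, integral_const_mul]
    rw [norm_norm, Real.norm_of_nonneg (integral_nonneg fun _ => norm_nonneg _)]
    exact mul_le_mul_of_nonneg_left (hL.integral_norm_transition_le _ g hg) (norm_nonneg _)
  have hWi : Integrable W := hi.integral_prod_right
  have hWc : Continuous W := by
    refine continuous_of_dominated (bound := fun s => ‖w s‖ * ‖g‖) ?_ ?_ (hw.norm.mul_const _) ?_
    · intro x
      exact hw.aestronglyMeasurable.mul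
        (hcont.comp (Continuous.prodMk_left x)).aestronglyMeasurable
    · intro x
      refine Eventually.of_forall fun s => ?_
      rw [norm_mul]
      exact mul_le_mul_of_nonneg_left
        ((abs_apply_le_norm _ x).trans (hL.norm_transition_le _ g)) (norm_nonneg _)
    · exact Eventually.of_forall fun s => continuous_const.mul (map_continuous _)
  have hF : fourierHat W =ᵐ[volume] k := by
    filter_upwards [hkg] with ξ hξ
    rw [← hξ]
    have hp := integrable_ofReal_mul_cexp (u := Prod.snd) hi measurable_snd ξ
    calc fourierHat W ξ
        = ∫ x : ℝ, ∫ s, ((w s * transition P (dual L) s.toNNReal g x : ℝ) : ℂ)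
            * cexp (I * ξ * x) ∂ν := by
          refine integral_congr_ae (Eventually.of_forall fun x => ?_)
          simp only [hW]
          rw [integral_mul_const, integral_complex_ofReal]
      _ = ∫ s, (∫ x : ℝ, ((w s * transition P (dual L) s.toNNReal g x : ℝ) : ℂ)
            * cexp (I * ξ * x)) ∂ν :=
          (integral_integral_swap (f := fun s (x : ℝ) =>
            ((w s * transition P (dual L) s.toNNReal g x : ℝ) : ℂ) * cexp (I * ξ * x)) hp).symm
      _ = fourierHat g ξ * ∫ s, w s * cexp (s.toNNReal * exponent P L ξ) ∂ν := by
          rw [← integral_const_mul]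
          refine integral_congr_ae (Eventually.of_forall fun s => ?_)
          simp only [ofReal_mul, mul_assoc, integral_const_mul]
          have := hL.fourierHat_transition s.toNNReal g hg ξ
          rw [fourierHat] at this
          simp only [mul_assoc] at this
          rw [this]
          ring
  rw [← fourierInvIntegral_fourierHat hWc hWi (hk.congr hF.symm) x]
  exact fourierInvIntegral_congr hF x

theorem IsLevyProcess.integrable_mul_cexp_exponent (hL : IsLevyProcess P L) (t : ℝ≥0) {h : ℝ → ℂ}
    (hh : Integrable h) : Integrable fun ξ => h ξ * cexp (t * exponent P L ξ) := by
  have := hL.measurable_exponent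
  exact hh.mul_bdd (c := 1) (by fun_prop) (Eventually.of_forall (hL.norm_cexp_exponent_le t))

theorem IsLevyProcess.transition_fourierInvC0 (hL : IsLevyProcess P L) (t : ℝ≥0) {h : ℝ → ℂ}
    (hh : Integrable h) (x : ℝ) : transition P (dual L) t (fourierInvC0 h hh) x =
      (fourierInvIntegral (fun ξ => h ξ * cexp (t * exponent P L ξ)) x).re := by
  have := hL.isProbabilityMeasure_map_dual t
  have hi : Integrable (fun y => fourierInvIntegral h (y + x)) (P.map (dual L t)) :=
    Integrable.of_bound ((continuous_fourierInvIntegral hh).comp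
      (continuous_add_const x)).aestronglyMeasurable _
      (Eventually.of_forall fun y => norm_fourierInvIntegral_le h (y + x))
  have hp : Integrable (fun p : ℝ × ℝ => h p.2 * cexp (-(I * (p.1 + x : ℝ) * p.2)))
      ((P.map (dual L t)).prod volume) :=
    (hh.comp_snd _).mul_bdd (c := 1) (by fun_prop)
      (Eventually.of_forall fun p => (norm_cexp_neg_I_mul_mul _ _).le)
  have e : ∫ y, fourierInvIntegral h (y + x) ∂(P.map (dual L t)) =
      fourierInvIntegral (fun ξ => h ξ * cexp (t * exponent P L ξ)) x := by
    simp only [fourierInvIntegral]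
    rw [integral_const_mul]
    congr 1
    rw [integral_integral_swap (f := fun y ξ : ℝ => h ξ * cexp (-(I * (y + x : ℝ) * ξ))) hp]
    refine integral_congr_ae (Eventually.of_forall fun ξ => ?_)
    simp only
    rw [integral_const_mul, mul_assoc]
    congr 1
    rw [← hL.integral_cexp_dual, ← integral_mul_const]
    refine integral_congr_ae (Eventually.of_forall fun y => ?_)
    simp only
    rw [← Complex.exp_add]
    congr 1
    push_cast
    ring
  rw [← e, transition_eq_integral_map]
  exact integral_re hi

/-! ### The resolvent and its limit -/

theorem IsLevyProcess.norm_exponent_le_norm_sub (hL : IsLevyProcess P L) {q : ℝ} (hq : 0 ≤ q)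
    (ξ : ℝ) : ‖exponent P L ξ‖ ≤ ‖(q : ℂ) - exponent P L ξ‖ := by
  have h := hL.exponent_re_nonpos ξ
  rw [← sq_le_sq₀ (norm_nonneg _) (norm_nonneg _), ← normSq_eq_norm_sq, ← normSq_eq_norm_sq,
    normSq_apply, normSq_apply]
  simp only [sub_re, ofReal_re, sub_im, ofReal_im]
  nlinarith

theorem IsLevyProcess.sub_exponent_ne_zero (hL : IsLevyProcess P L) {q : ℝ} (hq : 0 < q)
    (ξ : ℝ) : (q : ℂ) - exponent P L ξ ≠ 0 := by
  intro h
  have h1 := congrArg re h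
  have h2 := hL.exponent_re_nonpos ξ
  simp only [sub_re, ofReal_re, zero_re] at h1
  linarith

theorem norm_div_sub_le {a z : ℂ} {q : ℝ} (hz : z ≠ 0) (h : ‖z‖ ≤ ‖(q : ℂ) - z‖) :
    ‖a / (q - z)‖ ≤ ‖a / z‖ := by
  rw [norm_div, norm_div]
  exact div_le_div_of_nonneg_left (norm_nonneg _) (norm_pos_iff.2 hz) h

/-- Since `Re η ≤ 0`, one has `|q - η| ≥ |η|`, so `G / (q - η)` is dominated by `G / η`. -/
theorem IsLevyProcess.integrable_div_sub_exponent (hL : IsLevyProcess P L)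
    (hη : ∀ᵐ ξ : ℝ, exponent P L ξ ≠ 0) {G : ℝ → ℂ}
    (hG : Integrable fun ξ => G ξ / exponent P L ξ) {q : ℝ} (hq : 0 < q) :
    Integrable fun ξ => G ξ / (q - exponent P L ξ) := by
  have hm := hL.measurable_exponent
  have h : AEStronglyMeasurable (fun ξ => G ξ / (q - exponent P L ξ)) := by
    have h1 : AEStronglyMeasurable
        (fun ξ => G ξ / exponent P L ξ * (exponent P L ξ / (q - exponent P L ξ))) :=
      hG.aestronglyMeasurable.mul
        (hm.div (measurable_const.sub hm)).aestronglyMeasurable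
    refine h1.congr ?_
    filter_upwards [hη] with ξ hξ
    have := hL.sub_exponent_ne_zero hq ξ
    field_simp
  refine hG.mono h ?_
  filter_upwards [hη] with ξ hξ
  exact norm_div_sub_le hξ (hL.norm_exponent_le_norm_sub hq.le ξ)

theorem IsLevyProcess.resolvent_eq_fourierInvIntegral (hL : IsLevyProcess P L) (g : C₀(ℝ, ℝ))
    (hg : Integrable fun x => g x) {q : ℝ} (hq : 0 < q)
    (hk : Integrable fun ξ => fourierHat g ξ / (q - exponent P L ξ)) (x : ℝ) :
    (resolvent P (dual L) q g x : ℂ) =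
      fourierInvIntegral (fun ξ => fourierHat g ξ / (q - exponent P L ξ)) x := by
  have hw : Integrable (fun s => Real.exp (-q * s)) (volume.restrict (Ioi 0)) :=
    integrableOn_exp_mul_Ioi (neg_lt_zero.2 hq) 0
  refine hL.integral_transition_eq hw g hg hk (Eventually.of_forall fun ξ => ?_) x
  have hre : (exponent P L ξ - q).re < 0 := by
    have := hL.exponent_re_nonpos ξ
    simp only [sub_re, ofReal_re]
    linarith
  have h1 : ∫ s in Ioi (0 : ℝ), (Real.exp (-q * s) : ℂ) * cexp (s.toNNReal * exponent P L ξ) =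
      ∫ s : ℝ in Ioi 0, cexp ((exponent P L ξ - q) * s) := by
    refine setIntegral_congr_fun measurableSet_Ioi fun s hs => ?_
    rw [Real.coe_toNNReal s (le_of_lt hs), ofReal_exp, ← Complex.exp_add]
    congr 1
    push_cast
    ring
  rw [h1, integral_exp_mul_complex_Ioi hre]
  have h2 := hL.sub_exponent_ne_zero hq ξ
  have h3 : exponent P L ξ - q ≠ 0 := fun h => h2 (by rw [← neg_sub, h, neg_zero])
  simp only [ofReal_zero, mul_zero, Complex.exp_zero]
  rw [← neg_sub (exponent P L ξ)]
  field_simp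

/-- Dominated convergence for the `L¹` distance of `-G / (q - η)` and `G / η`, which bounds the
uniform distance of the inverse Fourier integrals. -/
theorem IsLevyProcess.tendsto_integral_norm_div_sub (hL : IsLevyProcess P L)
    (hη : ∀ᵐ ξ : ℝ, exponent P L ξ ≠ 0) {G : ℝ → ℂ}
    (hG : Integrable fun ξ => G ξ / exponent P L ξ) :
    Tendsto (fun q : ℝ => ∫ ξ, ‖-(G ξ / (q - exponent P L ξ)) - G ξ / exponent P L ξ‖)
      (𝓝[>] 0) (𝓝 0) := by
  have key : Tendsto (fun q : ℝ => ∫ ξ, ‖-(G ξ / (q - exponent P L ξ)) - G ξ / exponent P L ξ‖)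
      (𝓝[>] 0) (𝓝 (∫ _ : ℝ, (0 : ℝ))) := by
    refine tendsto_integral_filter_of_dominated_convergence
      (fun ξ => 2 * ‖G ξ / exponent P L ξ‖) ?_ ?_ (hG.norm.const_mul 2) ?_
    · filter_upwards [self_mem_nhdsWithin] with q hq
      exact ((hL.integrable_div_sub_exponent hη hG hq).neg.sub hG).norm.aestronglyMeasurable
    · filter_upwards [self_mem_nhdsWithin] with q hq
      filter_upwards [hη] with ξ hξ
      rw [norm_norm]
      have h1 := norm_sub_le (-(G ξ / (q - exponent P L ξ))) (G ξ / exponent P L ξ)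
      have h2 := norm_div_sub_le (a := G ξ) hξ
        (hL.norm_exponent_le_norm_sub (le_of_lt (show 0 < q from hq)) ξ)
      rw [norm_neg] at h1
      linarith
    · filter_upwards [hη] with ξ hξ
      have hc : ContinuousAt
          (fun q : ℝ => ‖-(G ξ / (q - exponent P L ξ)) - G ξ / exponent P L ξ‖) 0 := by
        have h0 : ((0 : ℝ) : ℂ) - exponent P L ξ ≠ 0 := by simpa using hξ
        have : ContinuousAt (fun q : ℝ => (q : ℂ) - exponent P L ξ) 0 := by fun_prop
        exact (((continuousAt_const.div this h0).neg).sub continuousAt_const).norm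
      have h := hc.tendsto
      have e : ‖-(G ξ / (((0 : ℝ) : ℂ) - exponent P L ξ)) - G ξ / exponent P L ξ‖ = 0 := by
        rw [ofReal_zero, zero_sub, div_neg, neg_neg, sub_self, norm_zero]
      rw [e] at h
      exact h.mono_left nhdsWithin_le_nhds
  simpa using key

/-! ### The Poisson equation -/

/-- Integrated form `P_t H - H = ∫_0^t P_s g ds` of the equation `A H = g`: both sides are the
inverse Fourier integral of `ĝ (e^{tη} - 1) / η`. -/
theorem IsLevyProcess.transition_sub_eq_setIntegral (hL : IsLevyProcess P L)
    (hη : ∀ᵐ ξ : ℝ, exponent P L ξ ≠ 0) (g : C₀(ℝ, ℝ)) (hg : Integrable fun x => g x)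
    (hgη : Integrable fun ξ => fourierHat g ξ / exponent P L ξ) (t : ℝ≥0) (x : ℝ) :
    transition P (dual L) t (fourierInvC0 _ hgη) x - fourierInvC0 _ hgη x =
      ∫ s in Ioc (0 : ℝ) t, transition P (dual L) s.toNNReal g x := by
  have ht := hL.integrable_mul_cexp_exponent t hgη
  rw [hL.transition_fourierInvC0, fourierInvC0_apply, ← sub_re,
    ← fourierInvIntegral_sub ht hgη]
  have key := hL.integral_transition_eq (ν := volume.restrict (Ioc (0 : ℝ) t)) (w := fun _ => 1)
    (integrable_const _) g hg (ht.sub hgη) ?_ x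
  · simp only [one_mul] at key
    have := congrArg re key
    rw [ofReal_re] at this
    exact this.symm
  · filter_upwards [hη] with ξ hξ
    have e : ∫ s in Ioc (0 : ℝ) t, ((1 : ℝ) : ℂ) * cexp (s.toNNReal * exponent P L ξ) =
        ∫ s in (0 : ℝ)..t, cexp (exponent P L ξ * s) := by
      rw [intervalIntegral.integral_of_le t.coe_nonneg]
      refine setIntegral_congr_fun measurableSet_Ioc fun s hs => ?_
      rw [Real.coe_toNNReal s hs.1.le, ofReal_one, one_mul, mul_comm]
    rw [e, integral_exp_mul_complex hξ]
    simp only [ofReal_zero, mul_zero, Complex.exp_zero, Pi.sub_apply]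
    rw [mul_comm (exponent P L ξ)]
    ring

theorem IsLevyProcess.isGeneratorLimit_fourierInvC0 (hL : IsLevyProcess P L)
    (hη : ∀ᵐ ξ : ℝ, exponent P L ξ ≠ 0) (g : C₀(ℝ, ℝ)) (hg : Integrable fun x => g x)
    (hgη : Integrable fun ξ => fourierHat g ξ / exponent P L ξ) :
    IsGeneratorLimit P (dual L) (fourierInvC0 _ hgη) g := by
  rw [IsGeneratorLimit, Metric.tendsto_nhds]
  intro ε hε
  have hc := (hL.continuous_transition g).tendsto 0
  rw [hL.transition_zero] at hc
  obtain ⟨δ, hδ, hδg⟩ := Metric.eventually_nhds_iff.1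
    (hc.eventually (Metric.closedBall_mem_nhds g (half_pos hε)))
  have h0 : ∀ᶠ t : ℝ≥0 in 𝓝[>] 0, dist t 0 < δ :=
    nhdsWithin_le_nhds (Metric.ball_mem_nhds 0 hδ)
  filter_upwards [h0, self_mem_nhdsWithin] with t htδ ht
  have ht0 : (0 : ℝ) < t := ht
  rw [dist_eq_norm]
  refine (norm_le_of_forall_apply_le (half_pos hε).le fun x => ?_).trans_lt (half_lt_self hε)
  have hcx : Continuous fun s : ℝ => transition P (dual L) s.toNNReal g x :=
    (hL.continuous_transition_uncurry g).comp (Continuous.prodMk_left x)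
  have hi : IntegrableOn (fun s : ℝ => transition P (dual L) s.toNNReal g x) (Ioc (0 : ℝ) t) :=
    (hcx.integrableOn_Icc).mono_set Ioc_subset_Icc_self
  have e : ∫ s in Ioc (0 : ℝ) t, (transition P (dual L) s.toNNReal g x - g x) =
      (∫ s in Ioc (0 : ℝ) t, transition P (dual L) s.toNNReal g x) - t * g x := by
    rw [integral_sub hi (integrable_const _), setIntegral_const]
    simp
  have hb : ‖∫ s in Ioc (0 : ℝ) t, (transition P (dual L) s.toNNReal g x - g x)‖
      ≤ ε / 2 * volume.real (Ioc (0 : ℝ) t) := by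
    refine norm_setIntegral_le_of_norm_le_const (by simp) fun s hs => ?_
    have hs1 : dist s.toNNReal 0 < δ := by
      rw [NNReal.dist_eq, NNReal.coe_zero, sub_zero, NNReal.abs_eq] at htδ ⊢
      rw [Real.coe_toNNReal s hs.1.le]
      exact hs.2.trans_lt htδ
    have h1 := hδg hs1
    rw [dist_eq_norm] at h1
    exact (abs_apply_le_norm _ x).trans h1
  rw [e, Real.volume_real_Ioc_of_le t.coe_nonneg, sub_zero] at hb
  have e2 : ((t : ℝ)⁻¹ • (transition P (dual L) t (fourierInvC0 _ hgη) - fourierInvC0 _ hgη) - g) x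
      = (t : ℝ)⁻¹ *
        ((∫ s in Ioc (0 : ℝ) t, transition P (dual L) s.toNNReal g x) - t * g x) := by
    rw [← hL.transition_sub_eq_setIntegral hη g hg hgη]
    simp only [ZeroAtInftyContinuousMap.sub_apply, ZeroAtInftyContinuousMap.smul_apply, smul_eq_mul]
    field_simp
  rw [e2, abs_mul, abs_of_pos (inv_pos.2 ht0), inv_mul_le_iff₀ ht0, mul_comm (t : ℝ) (ε / 2)]
  exact hb

/-! ### Injectivity of the generator -/

theorem IsLevyProcess.norm_transition_nsmul_sub_le (hL : IsLevyProcess P L) (f : C₀(ℝ, ℝ))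
    (h : ℝ≥0) (n : ℕ) :
    ‖transition P (dual L) (n • h) f - f‖ ≤ n * ‖transition P (dual L) h f - f‖ := by
  induction n with
  | zero => simp [hL.transition_zero]
  | succ n ih =>
    have e : transition P (dual L) ((n + 1) • h) f - f =
        transition P (dual L) (n • h) (transition P (dual L) h f - f) +
          (transition P (dual L) (n • h) f - f) := by
      rw [succ_nsmul, hL.transition_add, map_sub]
      abel
    rw [e]
    push_cast
    have h1 := hL.norm_transition_le (n • h) (transition P (dual L) h f - f)
    have h2 := norm_add_le (transition P (dual L) (n • h) (transition P (dual L) h f - f))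
      (transition P (dual L) (n • h) f - f)
    linarith

/-- Functions annihilated by the generator are invariant: telescoping over `n` steps of length
`t / n` bounds `‖P_t f - f‖` by `t ‖(P_{t/n} f - f) / (t/n)‖`, which tends to `0`. -/
theorem IsLevyProcess.transition_eq_self_of_isGeneratorLimit_zero (hL : IsLevyProcess P L)
    {f : C₀(ℝ, ℝ)} (hf : IsGeneratorLimit P (dual L) f 0) (t : ℝ≥0) :
    transition P (dual L) t f = f := by
  rcases eq_or_ne t 0 with rfl | ht
  · exact hL.transition_zero f
  have ht0 : 0 < t := pos_iff_ne_zero.2 ht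
  have hu : Tendsto (fun n : ℕ => t / (n + 1)) atTop (𝓝[>] 0) := by
    refine tendsto_nhdsWithin_iff.2 ⟨?_, Eventually.of_forall fun n => ?_⟩
    · rw [← NNReal.tendsto_coe]
      push_cast
      exact tendsto_const_nhds.div_atTop
        (tendsto_atTop_add_const_right _ 1 tendsto_natCast_atTop_atTop)
    · exact div_pos ht0 (by positivity)
  have h1 := ((hf.comp hu).norm).const_mul (t : ℝ)
  rw [norm_zero, mul_zero] at h1
  have h2 : ‖transition P (dual L) t f - f‖ ≤ 0 := by
    refine ge_of_tendsto' h1 fun n => ?_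
    have h3 := hL.norm_transition_nsmul_sub_le f (t / (n + 1)) (n + 1)
    have e : (n + 1) • (t / ((n : ℝ≥0) + 1)) = t := by
      rw [nsmul_eq_mul]
      push_cast
      exact mul_div_cancel₀ t (by positivity)
    rw [e] at h3
    refine h3.trans_eq ?_
    have ht' : (t : ℝ) ≠ 0 := by exact_mod_cast ht
    simp only [Function.comp_apply]
    rw [norm_smul, norm_inv, Real.norm_of_nonneg (NNReal.coe_nonneg _)]
    push_cast
    field_simp
  exact sub_eq_zero.1 (norm_le_zero_iff.1 h2)

/-- Strong maximum principle: an invariant function equals its maximum at `μ`-almost all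
translates of a maximum point. The set of maximum points is compact if the maximum is positive, and
its largest and smallest elements show that `μ` charges neither `(0, ∞)` nor `(-∞, 0)`. -/
theorem ae_eq_zero_of_translateAverage_eq {μ : Measure ℝ} [IsProbabilityMeasure μ] {f : C₀(ℝ, ℝ)}
    (hf : translateAverage μ f = f) {x₀ : ℝ} (hx₀ : 0 < f x₀) : ∀ᵐ y ∂μ, y = 0 := by
  have hz := zero_at_infty f
  obtain ⟨a, ha⟩ : ∃ a, ∀ x, f x ≤ f a := by
    refine f.continuous.exists_forall_ge' x₀ ?_
    filter_upwards [hz.eventually (gt_mem_nhds hx₀)] with x hx using hx.le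
  have hpos : 0 < f a := hx₀.trans_le (ha x₀)
  set M : Set ℝ := {x | f a ≤ f x} with hM
  have hMc : IsCompact M := by
    have hcl : IsClosed M := isClosed_le continuous_const f.continuous
    have hco : Mᶜ ∈ cocompact ℝ := by
      filter_upwards [hz.eventually (gt_mem_nhds hpos)] with x hx
      exact not_le.2 hx
    obtain ⟨K, hK, hKM⟩ := mem_cocompact.1 hco
    exact hK.of_isClosed_subset hcl (compl_subset_compl.1 hKM)
  have hMne : M.Nonempty := ⟨a, le_refl (f a)⟩
  have hstep : ∀ b ∈ M, ∀ᵐ y ∂μ, y + b ∈ M := by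
    intro b hb
    have hfb : f b = f a := le_antisymm (ha b) hb
    have hi := integrable_comp_add μ f b
    have h1 : ∫ y, (f a - f (y + b)) ∂μ = 0 := by
      have h2 : ∫ y, f (y + b) ∂μ = f b := DFunLike.congr_fun hf b
      rw [integral_sub (integrable_const _) hi, h2, hfb]
      simp
    rw [integral_eq_zero_iff_of_nonneg (fun y => sub_nonneg.2 (ha _))
      ((integrable_const _).sub hi)] at h1
    filter_upwards [h1] with y hy
    exact (sub_eq_zero.1 hy).le
  filter_upwards [hstep _ (hMc.sSup_mem hMne), hstep _ (hMc.sInf_mem hMne)] with y h1 h2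
  have h3 := le_csSup hMc.bddAbove h1
  have h4 := csInf_le hMc.bddBelow h2
  linarith

theorem IsLevyProcess.eq_zero_of_isGeneratorLimit_zero (hL : IsLevyProcess P L)
    (hnontriv : ¬ ∀ t : ℝ≥0, ∀ᵐ ω ∂P, L t ω = 0) {f : C₀(ℝ, ℝ)}
    (hf : IsGeneratorLimit P (dual L) f 0) : f = 0 := by
  by_contra hne
  obtain ⟨x, hx⟩ : ∃ x, f x ≠ 0 := by
    by_contra! h
    exact hne (by ext x; exact h x)
  refine hnontriv fun t => ?_
  have := hL.isProbabilityMeasure_map_dual t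
  have ht : translateAverage (P.map (dual L t)) f = f :=
    hL.transition_eq_self_of_isGeneratorLimit_zero hf t
  have h0 : ∀ᵐ y ∂(P.map (dual L t)), y = 0 := by
    rcases hx.lt_or_gt with h | h
    · exact ae_eq_zero_of_translateAverage_eq (f := -f) (by rw [map_neg, ht]) (x₀ := x)
        (by simpa using h)
    · exact ae_eq_zero_of_translateAverage_eq ht h
  filter_upwards [ae_of_ae_map (hL.measurable_dual t).aemeasurable h0] with ω hω
  simpa [dual] using hω

end LevyPoisson

/-! ### Solution of the Poisson equation -/

theorem propositionp1 {Ω : Type*} [MeasurableSpace Ω] (P : Measure Ω) [IsProbabilityMeasure P]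
    (L : ℝ≥0 → Ω → ℝ) (hL : LevyPoisson.IsLevyProcess P L)
    (hnontriv : ¬ ∀ t : ℝ≥0, ∀ᵐ ω ∂P, L t ω = 0)
    (g : C₀(ℝ, ℝ)) (hg : Integrable (fun x => g x))
    (hgη : Integrable fun ξ : ℝ => LevyPoisson.fourierHat g ξ / LevyPoisson.exponent P L ξ) :
    ∃ H : (LevyPoisson.generator P (LevyPoisson.dual L)).domain,
      LevyPoisson.generator P (LevyPoisson.dual L) H = g ∧
      (∀ H' : (LevyPoisson.generator P (LevyPoisson.dual L)).domain,
        LevyPoisson.generator P (LevyPoisson.dual L) H' = g → H' = H) ∧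
      (∀ x : ℝ, (((H : C₀(ℝ, ℝ)) x : ℝ) : ℂ) =
        1 / (2 * Real.pi) * ∫ ξ : ℝ,
          LevyPoisson.fourierHat g ξ / LevyPoisson.exponent P L ξ * cexp (-(I * x * ξ))) ∧
      ∃ R : ℝ → C₀(ℝ, ℝ),
        (∀ q : ℝ, 0 < q → ∀ x : ℝ, R q x = LevyPoisson.resolvent P (LevyPoisson.dual L) q g x) ∧
        Tendsto (fun q => -R q) (𝓝[>] 0) (𝓝 (H : C₀(ℝ, ℝ))) := by
  have hη := hL.ae_exponent_ne_zero hnontriv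
  have hlim := hL.isGeneratorLimit_fourierInvC0 hη g hg hgη
  have hgen : LevyPoisson.generator P (LevyPoisson.dual L)
      ⟨LevyPoisson.fourierInvC0 _ hgη, ⟨g, hlim⟩⟩ = g :=
    (LevyPoisson.generator_eq_iff _ _ _ _).2 hlim
  have hk := fun (q : ℝ) (hq : 0 < q) => hL.integrable_div_sub_exponent hη hgη hq
  have hres := fun (q : ℝ) (hq : 0 < q) =>
    hL.resolvent_eq_fourierInvIntegral g hg hq (hk q hq)
  have hint := (hL.tendsto_integral_norm_div_sub hη hgη).const_mul (1 / (2 * Real.pi))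
  rw [mul_zero] at hint
  have hsub : ∀ q : ℝ, (hq : 0 < q) → ∀ x, LevyPoisson.fourierInvIntegral
      (fun ξ => -(LevyPoisson.fourierHat g ξ / (q - LevyPoisson.exponent P L ξ)) -
        LevyPoisson.fourierHat g ξ / LevyPoisson.exponent P L ξ) x =
      -(LevyPoisson.resolvent P (LevyPoisson.dual L) q g x : ℂ) -
        LevyPoisson.fourierInvIntegral
          (fun ξ => LevyPoisson.fourierHat g ξ / LevyPoisson.exponent P L ξ) x := by
    intro q hq x
    refine (LevyPoisson.fourierInvIntegral_sub (hk q hq).neg hgη x).trans ?_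
    rw [hres q hq]
    congr 1
    simp only [LevyPoisson.fourierInvIntegral, Pi.neg_apply, neg_mul, integral_neg, mul_neg]
  refine ⟨⟨LevyPoisson.fourierInvC0 _ hgη, ⟨g, hlim⟩⟩, hgen, ?_, ?_, ?_⟩
  · intro H' hH'
    have h0 := (LevyPoisson.generator_eq_iff P (LevyPoisson.dual L)
      (H' - ⟨LevyPoisson.fourierInvC0 _ hgη, ⟨g, hlim⟩⟩) 0).1
        (by rw [LinearPMap.map_sub, hH', hgen, sub_self])
    have h1 := hL.eq_zero_of_isGeneratorLimit_zero hnontriv h0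
    exact sub_eq_zero.1 (Subtype.ext h1)
  · intro x
    -- The integral is real because it is a limit of the real numbers `-U^q g(x)`.
    have hi : |(LevyPoisson.fourierInvIntegral
        (fun ξ => LevyPoisson.fourierHat g ξ / LevyPoisson.exponent P L ξ) x).im| ≤ 0 := by
      refine ge_of_tendsto hint ?_
      filter_upwards [self_mem_nhdsWithin] with q hq
      refine le_trans ?_ (LevyPoisson.norm_fourierInvIntegral_le _ x)
      rw [hsub q hq x]
      refine le_trans (le_of_eq ?_) (abs_im_le_norm _)
      simp
    have hi' := abs_nonpos_iff.1 hi
    exact Complex.ext rfl hi'.symm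
  · refine ⟨fun q => if hq : 0 < q then LevyPoisson.fourierInvC0 _ (hk q hq) else 0, ?_, ?_⟩
    · intro q hq x
      simp only [hq, dif_pos]
      rw [LevyPoisson.fourierInvC0_apply, ← hres q hq, ofReal_re]
    · rw [tendsto_iff_norm_sub_tendsto_zero]
      refine squeeze_zero' (Eventually.of_forall fun _ => norm_nonneg _) ?_ hint
      filter_upwards [self_mem_nhdsWithin] with q hq
      have hq' : 0 < q := hq
      refine LevyPoisson.norm_le_of_forall_apply_le
        (mul_nonneg (by positivity) (integral_nonneg fun _ => norm_nonneg _)) fun x => ?_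
      refine le_trans (le_trans (le_of_eq ?_) (abs_re_le_norm _))
        (LevyPoisson.norm_fourierInvIntegral_le _ x)
      rw [hsub q hq x]
      simp only [hq', dif_pos]
      rw [ZeroAtInftyContinuousMap.sub_apply, ZeroAtInftyContinuousMap.neg_apply,
        LevyPoisson.fourierInvC0_apply, LevyPoisson.fourierInvC0_apply, ← hres q hq, ofReal_re,
        sub_re, neg_re, ofReal_re]
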